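/- **Theorem 2.** Consider the following two-player zero-sum game $G$ (a Pursuit-Evasion Game with incomplete information and arbitrary signal spaces). The Maximizer (player $1$) and the Minimizer (player $2$) have nonempty finite action sets $A^1,A^2$ and arbitrary measurable spaces $S^1,S^2$ of signals. Let $H_n=(A^1\times A^2)^n$ and $H=\bigcup_{n\ge 0}H_n$. A daily payoff function $f:H\to[0,\infty)$ and, for every $h\in H$, probability distributions $p_h^1$ on $S^1$ and $p_h^2$ on $S^2$ are given. At each stage $n\ge 0$, starting from the empty history $h_0$, the players choose actions $a^1,a^2$ simultaneously and independently, the history becomes $h_{n+1}=h_n\frown\langle a^1,a^2\rangle$, signals $\langle s^1,s^2\rangle$ are drawn from $p^1_{h_{n+1}}\times p^2_{h_{n+1}}$, and player $i$ observes only $s^i$. A (behavioral) strategy of player $i$ is a measurable map $\sigma^i$ from the private histories $\bigcup_n(A^i\times S^i)^n$ (own actions and own signals) to the probability distributions on $A^i$. A pair $\langle\sigma^1,\sigma^2\rangle$ induces a probability measure $\mu_{\sigma^1,\sigma^2}$ on the infinite histories $(A^1\times A^2)^{\mathbb N}$. The payoff of an infinite history $h$ is $\rho(h)=\sum_{n\ge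 0}f(h_n)$, where $h_n$ is its prefix of length $n$. Put $\mathrm{val}_G(\sigma^1)=\inf_{\sigma^2}E_{\mu_{\sigma^1,\sigma^2}}(\rho)$ and $\mathrm{val}_G(\sigma^2)=\sup_{\sigma^1}E_{\mu_{\sigma^1,\sigma^2}}(\rho)$. The game has a value $\mathrm{val}(G)$ if $\sup_{\sigma^1}\mathrm{val}_G(\sigma^1)=\inf_{\sigma^2}\mathrm{val}_G(\sigma^2)$, the common number being $\mathrm{val}(G)$; a strategy $\sigma^i$ is then $\epsilon$-optimal in $G$ if $|\mathrm{val}_G(\sigma^i)-\mathrm{val}(G)|<\epsilon$. Let $G_n$ be the same game with $f$ replaced by $f_n$, equal to $f$ on histories of length at most $n$ and to $0$ on all others. If $\rho$ is bounded on $(A^1\times A^2)^{\mathbb N}$, then $G$ has a uniform value: $G$ has a value, and for every $\epsilon>0$ there are $N$ and strategies $\sigma^1,\sigma^2$ of the two players such that, for every $n>N$, the game $G_n$ has a value and both $\sigma^1$ and $\sigma^2$ are $\epsilon$-optimal in $G_n$. -/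

import Mathlib

open MeasureTheory ProbabilityTheory
open scoped NNReal ENNReal

noncomputable section

/-- A pursuit-evasion game with incomplete information (a cumulative game with nonnegative daily
payoffs), with action sets `A₁`, `A₂` and measurable signal spaces `S₁`, `S₂`.  Player 1 is the
Maximizer and player 2 the Minimizer.  A history of length `n` is a map `Fin n → A₁ × A₂`. -/
structure PursuitEvasionGame (A₁ A₂ S₁ S₂ : Type*) [MeasurableSpace S₁] [MeasurableSpace S₂] where
  /-- The daily payoff of each finite history. -/
  f : ∀ n : ℕ, (Fin n → A₁ × A₂) → ℝ≥0
  /-- The distribution of player 1's signal, for each finite history. -/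
  p₁ : ∀ n : ℕ, (Fin n → A₁ × A₂) → ProbabilityMeasure S₁
  /-- The distribution of player 2's signal, for each finite history. -/
  p₂ : ∀ n : ℕ, (Fin n → A₁ × A₂) → ProbabilityMeasure S₂

/-- A behavioral strategy of a player with actions `A` and signals `S`: a (measurable) map from
the private histories, i.e. the sequences of pairs (own action, own signal), to the probability
distributions on `A`. -/
structure BehavioralStrategy (A S : Type*) [MeasurableSpace A] [MeasurableSpace S] where
  /-- The mixed action used after each private history of length `n`. -/
  act : ∀ n : ℕ, Kernel (Fin n → A × S) A
  isMarkov : ∀ n : ℕ, IsMarkovKernel (act n)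

attribute [instance] BehavioralStrategy.isMarkov

namespace PursuitEvasionGame

/-- What happens at one stage: the pair of actions and the pair of signals. -/
abbrev Stage (A₁ A₂ S₁ S₂ : Type*) : Type _ := (A₁ × A₂) × (S₁ × S₂)

/-- The public history contained in a finite sequence of stages. -/
def hist {A₁ A₂ S₁ S₂ : Type*} {n : ℕ} (z : Fin n → Stage A₁ A₂ S₁ S₂) : Fin n → A₁ × A₂ :=
  fun i => (z i).1

/-- The private history of player 1. -/
def priv₁ {A₁ A₂ S₁ S₂ : Type*} {n : ℕ} (z : Fin n → Stage A₁ A₂ S₁ S₂) : Fin n → A₁ × S₁ :=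
  fun i => ((z i).1.1, (z i).2.1)

/-- The private history of player 2. -/
def priv₂ {A₁ A₂ S₁ S₂ : Type*} {n : ℕ} (z : Fin n → Stage A₁ A₂ S₁ S₂) : Fin n → A₂ × S₂ :=
  fun i => ((z i).1.2, (z i).2.2)

section measurability

variable {A₁ A₂ S₁ S₂ : Type*} [MeasurableSpace A₁] [MeasurableSpace A₂]
  [MeasurableSpace S₁] [MeasurableSpace S₂]

lemma measurable_priv₁ (n : ℕ) :
    Measurable (priv₁ : (Fin n → Stage A₁ A₂ S₁ S₂) → Fin n → A₁ × S₁) := by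
  unfold priv₁; fun_prop

lemma measurable_priv₂ (n : ℕ) :
    Measurable (priv₂ : (Fin n → Stage A₁ A₂ S₁ S₂) → Fin n → A₂ × S₂) := by
  unfold priv₂; fun_prop

/-- The public history after appending the pair of actions just chosen. -/
def nextHist (n : ℕ) (x : (Fin n → Stage A₁ A₂ S₁ S₂) × (A₁ × A₂)) : Fin (n + 1) → A₁ × A₂ :=
  Fin.snoc (hist x.1) x.2

lemma measurable_nextHist (n : ℕ) :
    Measurable (nextHist n :
      (Fin n → Stage A₁ A₂ S₁ S₂) × (A₁ × A₂) → Fin (n + 1) → A₁ × A₂) := by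
  refine measurable_pi_lambda _ fun i => ?_
  refine Fin.lastCases ?_ (fun j => ?_) i
  · simp only [nextHist, Fin.snoc_last]; fun_prop
  · simp only [nextHist, Fin.snoc_castSucc, hist]; fun_prop

end measurability

section play

variable {A₁ A₂ S₁ S₂ : Type*}
  [MeasurableSpace A₁] [DiscreteMeasurableSpace A₁] [Finite A₁]
  [MeasurableSpace A₂] [DiscreteMeasurableSpace A₂] [Finite A₂]
  [MeasurableSpace S₁] [MeasurableSpace S₂]

/-- The law of the signal pair drawn at the history `h`: the product of the two players' signal
distributions. -/
def signalKernel (G : PursuitEvasionGame A₁ A₂ S₁ S₂) (n : ℕ) :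
    Kernel (Fin n → A₁ × A₂) (S₁ × S₂) :=
  Kernel.ofFunOfCountable fun h => (G.p₁ n h : Measure S₁).prod (G.p₂ n h : Measure S₂)

instance (G : PursuitEvasionGame A₁ A₂ S₁ S₂) (n : ℕ) : IsMarkovKernel (G.signalKernel n) :=
  ⟨fun h => by
    change IsProbabilityMeasure ((G.p₁ n h : Measure S₁).prod (G.p₂ n h : Measure S₂))
    infer_instance⟩

/-- The law of the pair of actions at stage `n`: given the past, the players choose independently,
each according to its strategy at its own private history. -/
def actionKernel (σ₁ : BehavioralStrategy A₁ S₁) (σ₂ : BehavioralStrategy A₂ S₂) (n : ℕ) :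
    Kernel (Fin n → Stage A₁ A₂ S₁ S₂) (A₁ × A₂) :=
  ((σ₁.act n).comap priv₁ (measurable_priv₁ n)) ×ₖ ((σ₂.act n).comap priv₂ (measurable_priv₂ n))

instance (σ₁ : BehavioralStrategy A₁ S₁) (σ₂ : BehavioralStrategy A₂ S₂) (n : ℕ) :
    IsMarkovKernel (actionKernel σ₁ σ₂ n) := by
  unfold actionKernel; infer_instance

/-- The law of stage `n` given the past: actions are chosen, the history is extended by them, and
a signal pair is drawn from the distributions attached to the new history. -/
def stageKernel (G : PursuitEvasionGame A₁ A₂ S₁ S₂)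
    (σ₁ : BehavioralStrategy A₁ S₁) (σ₂ : BehavioralStrategy A₂ S₂) (n : ℕ) :
    Kernel (Fin n → Stage A₁ A₂ S₁ S₂) (Stage A₁ A₂ S₁ S₂) :=
  actionKernel σ₁ σ₂ n ⊗ₖ (G.signalKernel (n + 1)).comap (nextHist n) (measurable_nextHist n)

instance (G : PursuitEvasionGame A₁ A₂ S₁ S₂)
    (σ₁ : BehavioralStrategy A₁ S₁) (σ₂ : BehavioralStrategy A₂ S₂) (n : ℕ) :
    IsMarkovKernel (G.stageKernel σ₁ σ₂ n) := by
  unfold stageKernel; infer_instance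

/-- The law of stage `n + 1` given stages `0, …, n`, as a kernel on functions on `Finset.Iic n`. -/
def stepKernel (G : PursuitEvasionGame A₁ A₂ S₁ S₂)
    (σ₁ : BehavioralStrategy A₁ S₁) (σ₂ : BehavioralStrategy A₂ S₂) (n : ℕ) :
    Kernel (Finset.Iic n → Stage A₁ A₂ S₁ S₂) (Stage A₁ A₂ S₁ S₂) :=
  (G.stageKernel σ₁ σ₂ (n + 1)).comap
    (fun x (i : Fin (n + 1)) => x ⟨(i : ℕ), Finset.mem_Iic.2 (Nat.le_of_lt_succ i.isLt)⟩)
    (measurable_pi_lambda _ fun _ => measurable_pi_apply _)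

instance (G : PursuitEvasionGame A₁ A₂ S₁ S₂)
    (σ₁ : BehavioralStrategy A₁ S₁) (σ₂ : BehavioralStrategy A₂ S₂) (n : ℕ) :
    IsMarkovKernel (G.stepKernel σ₁ σ₂ n) := by
  unfold stepKernel; infer_instance

/-- The law of the infinite sequence of stages under a profile. -/
def playMeasure (G : PursuitEvasionGame A₁ A₂ S₁ S₂)
    (σ₁ : BehavioralStrategy A₁ S₁) (σ₂ : BehavioralStrategy A₂ S₂) :
    Measure (ℕ → Stage A₁ A₂ S₁ S₂) :=
  Kernel.trajMeasure (X := fun _ => Stage A₁ A₂ S₁ S₂)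
    (G.stageKernel σ₁ σ₂ 0 Fin.elim0) (G.stepKernel σ₁ σ₂)

/-- The law of the infinite history of actions under a profile. -/
def historyMeasure (G : PursuitEvasionGame A₁ A₂ S₁ S₂)
    (σ₁ : BehavioralStrategy A₁ S₁) (σ₂ : BehavioralStrategy A₂ S₂) :
    Measure (ℕ → A₁ × A₂) :=
  (G.playMeasure σ₁ σ₂).map fun z n => (z n).1

/-- The payoff of an infinite history: the sum of the daily payoffs of its finite prefixes. -/
def payoff (G : PursuitEvasionGame A₁ A₂ S₁ S₂) (h : ℕ → A₁ × A₂) : ℝ≥0∞ :=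
  ∑' n : ℕ, (G.f n (fun i : Fin n => h i) : ℝ≥0∞)

/-- The expected payoff of a profile. -/
def expectedPayoff (G : PursuitEvasionGame A₁ A₂ S₁ S₂)
    (σ₁ : BehavioralStrategy A₁ S₁) (σ₂ : BehavioralStrategy A₂ S₂) : ℝ≥0∞ :=
  ∫⁻ h, G.payoff h ∂(G.historyMeasure σ₁ σ₂)

/-- The value of a strategy of the Maximizer. -/
def val₁ (G : PursuitEvasionGame A₁ A₂ S₁ S₂) (σ₁ : BehavioralStrategy A₁ S₁) : ℝ≥0∞ :=
  ⨅ σ₂ : BehavioralStrategy A₂ S₂, G.expectedPayoff σ₁ σ₂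

/-- The value of a strategy of the Minimizer. -/
def val₂ (G : PursuitEvasionGame A₁ A₂ S₁ S₂) (σ₂ : BehavioralStrategy A₂ S₂) : ℝ≥0∞ :=
  ⨆ σ₁ : BehavioralStrategy A₁ S₁, G.expectedPayoff σ₁ σ₂

/-- The lower value of the game. -/
def lowerVal (G : PursuitEvasionGame A₁ A₂ S₁ S₂) : ℝ≥0∞ :=
  ⨆ σ₁ : BehavioralStrategy A₁ S₁, G.val₁ σ₁

/-- The upper value of the game. -/
def upperVal (G : PursuitEvasionGame A₁ A₂ S₁ S₂) : ℝ≥0∞ :=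
  ⨅ σ₂ : BehavioralStrategy A₂ S₂, G.val₂ σ₂

/-- `v` is the value of the game: a finite number equal to the lower and to the upper value. -/
def IsValue (G : PursuitEvasionGame A₁ A₂ S₁ S₂) (v : ℝ≥0) : Prop :=
  G.lowerVal = v ∧ G.upperVal = v

/-- `σ₁` is `ε`-optimal for the Maximizer: the game has a value `v` and
`|val(σ₁) - v| < ε`, written without subtraction. -/
def IsEpsOptimal₁ (G : PursuitEvasionGame A₁ A₂ S₁ S₂) (ε : ℝ≥0)
    (σ₁ : BehavioralStrategy A₁ S₁) : Prop :=
  ∃ v : ℝ≥0, G.IsValue v ∧ G.val₁ σ₁ < v + ε ∧ (v : ℝ≥0∞) < G.val₁ σ₁ + ε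

/-- `σ₂` is `ε`-optimal for the Minimizer: the game has a value `v` and
`|val(σ₂) - v| < ε`, written without subtraction. -/
def IsEpsOptimal₂ (G : PursuitEvasionGame A₁ A₂ S₁ S₂) (ε : ℝ≥0)
    (σ₂ : BehavioralStrategy A₂ S₂) : Prop :=
  ∃ v : ℝ≥0, G.IsValue v ∧ G.val₂ σ₂ < v + ε ∧ (v : ℝ≥0∞) < G.val₂ σ₂ + ε

/-- The game `G_n`: daily payoffs of histories of length more than `n` are replaced by zero. -/
def truncate (G : PursuitEvasionGame A₁ A₂ S₁ S₂) (n : ℕ) : PursuitEvasionGame A₁ A₂ S₁ S₂ where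
  f m h := if m ≤ n then G.f m h else 0
  p₁ := G.p₁
  p₂ := G.p₂

/-- The payoff function is bounded on the set of infinite histories. -/
def IsBounded (G : PursuitEvasionGame A₁ A₂ S₁ S₂) : Prop :=
  ∃ B : ℝ≥0, ∀ h : ℕ → A₁ × A₂, G.payoff h < B

/-- The game has a value, and for each `ε > 0` both players have strategies that are `ε`-optimal
in all sufficiently long truncations of the game. -/
def HasUniformValue (G : PursuitEvasionGame A₁ A₂ S₁ S₂) : Prop :=
  (∃ v : ℝ≥0, G.IsValue v) ∧
    ∀ ε : ℝ≥0, 0 < ε → ∃ (N : ℕ) (σ₁ : BehavioralStrategy A₁ S₁) (σ₂ : BehavioralStrategy A₂ S₂),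
      ∀ n : ℕ, N < n → (G.truncate n).IsEpsOptimal₁ ε σ₁ ∧ (G.truncate n).IsEpsOptimal₂ ε σ₂

end play

end PursuitEvasionGame

end

/-! Given the public history, the private histories of the two players are independent. The
probability of a public history is therefore the product of two factors, each depending on the
strategy of one player only, and the expected payoff of a truncated game is a bilinear form in the
families of these factors, the realization vectors of the players.

The set of realization vectors of a player is convex and compact. Only closedness is delicate, as
strategies over arbitrary signal spaces carry no compact topology. Given a limit of realization
vectors, elements of almost minimal norm in a decreasing sequence of convex sets of realization
plans form a Cauchy sequence in `L²`; a subsequence converges almost everywhere, and its limit is a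
plan that realizes the limit vector.

Hence Sion's minimax theorem gives every truncated game a value and optimal strategies. These values
increase to a limit `v`, and by compactness some strategy of the Minimizer guarantees `v` in all
truncated games at once, hence in the whole game. A strategy of the Maximizer that is optimal in a
long enough truncated game guarantees almost `v` in all longer ones.
-/

noncomputable section

open Filter Topology

section Measurability

variable {X Y : Type*} [MeasurableSpace X] [MeasurableSpace Y] {n : ℕ}

lemma measurable_fin_snoc {f : Y → Fin n → X} {g : Y → X} (hf : Measurable f) (hg : Measurable g) :
    Measurable fun y => (Fin.snoc (f y) (g y) : Fin (n + 1) → X) := by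
  refine measurable_pi_lambda _ (Fin.lastCases ?_ fun j => ?_)
  · simpa only [Fin.snoc_last] using hg
  · simpa only [Fin.snoc_castSucc, Function.comp_def] using (measurable_pi_apply j).comp hf

lemma measurable_fin_init : Measurable fun z : Fin (n + 1) → X => (Fin.init z : Fin n → X) :=
  measurable_pi_lambda _ fun _ => measurable_pi_apply _

lemma measurable_sigma_mk {ι : Type*} {X : ι → Type*} [∀ i, MeasurableSpace (X i)] (i : ι) :
    Measurable (Sigma.mk i : X i → Sigma X) :=
  fun _ ht => MeasurableSpace.measurableSet_iInf.1 ht i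

lemma measurable_of_sigma {ι : Type*} {X : ι → Type*} [∀ i, MeasurableSpace (X i)]
    {f : Sigma X → Y} (hf : ∀ i, Measurable fun x => f ⟨i, x⟩) : Measurable f :=
  fun _ ht => MeasurableSpace.measurableSet_iInf.2 fun i => hf i ht

lemma measurable_kernel_singleton [Countable X] [DiscreteMeasurableSpace X] (κ : Kernel Y X) :
    Measurable fun y : Y × X => κ y.1 {y.2} :=
  measurable_from_prod_countable_left fun x => κ.measurable_coe (measurableSet_singleton x)

lemma map_compProd_eq_compProd_comap {Z : Type*} [MeasurableSpace Z] (μ : Measure X) [SFinite μ]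
    {r : X → Y} (hr : Measurable r) (κ : Kernel Y Z) [IsSFiniteKernel κ] :
    (μ.map r) ⊗ₘ κ = (μ ⊗ₘ κ.comap r hr).map (Prod.map r id) := by
  have hr' : Measurable (Prod.map r (id : Z → Z)) := hr.prodMap measurable_id
  ext s hs
  rw [Measure.compProd_apply hs, lintegral_map (Kernel.measurable_kernel_prodMk_left hs) hr,
    Measure.map_apply hr' hs, Measure.compProd_apply (hr' hs)]
  rfl

end Measurability

section Convexity

lemma norm_sub_sq_le_of_convex {E : Type*} [NormedAddCommGroup E] [InnerProductSpace ℝ E]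
    {s : Set E} (hs : Convex ℝ s) {d : ℝ} (hd : ∀ z ∈ s, d ≤ ‖z‖ ^ 2) {x y : E} (hx : x ∈ s)
    (hy : y ∈ s) : ‖x - y‖ ^ 2 ≤ 2 * (‖x‖ ^ 2 - d) + 2 * (‖y‖ ^ 2 - d) := by
  have hmid : (2⁻¹ : ℝ) • x + (2⁻¹ : ℝ) • y ∈ s :=
    hs hx hy (by norm_num) (by norm_num) (by norm_num)
  have hmid_le := hd _ hmid
  rw [← smul_add, norm_smul, Real.norm_of_nonneg (by norm_num), mul_pow] at hmid_le
  linarith [parallelogram_law_with_norm ℝ x y]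

/- Take `x k` almost of minimal norm in `D k`: the infima of the squared norms increase to a finite
limit, so by the parallelogram law the sequence is Cauchy. -/
theorem exists_seq_tendsto_of_antitone_convex {E : Type*} [NormedAddCommGroup E]
    [InnerProductSpace ℝ E] [CompleteSpace E] {D : ℕ → Set E} (hanti : Antitone D)
    (hconv : ∀ k, Convex ℝ (D k)) (hne : ∀ k, (D k).Nonempty) (hbdd : Bornology.IsBounded (D 0)) :
    ∃ (x : ℕ → E) (l : E), (∀ k, x k ∈ D k) ∧ Tendsto x atTop (𝓝 l) := by
  obtain ⟨R, hR⟩ := hbdd.exists_norm_le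
  let d k := sInf ((‖·‖ ^ 2) '' D k)
  have hbelow k : BddBelow ((‖·‖ ^ 2) '' D k) := ⟨0, by rintro _ ⟨x, -, rfl⟩; positivity⟩
  have hd k : ∀ x ∈ D k, d k ≤ ‖x‖ ^ 2 := fun x hx => csInf_le (hbelow k) ⟨x, hx, rfl⟩
  have hmono : Monotone d := fun j k hjk =>
    csInf_le_csInf (hbelow j) ((hne k).image _) (Set.image_mono (hanti hjk))
  have habove : BddAbove (Set.range d) := by
    refine ⟨R ^ 2, ?_⟩
    rintro _ ⟨k, rfl⟩
    obtain ⟨x, hx⟩ := hne k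
    exact (hd k x hx).trans (by gcongr; exact hR x (hanti k.zero_le hx))
  have hnear k : ∃ x ∈ D k, ‖x‖ ^ 2 < d k + 1 / ((k : ℝ) + 1) := by
    obtain ⟨_, ⟨x, hx, rfl⟩, hlt⟩ := exists_lt_of_csInf_lt ((hne k).image (‖·‖ ^ 2))
      (lt_add_of_pos_right (d k) (by positivity : 0 < 1 / ((k : ℝ) + 1)))
    exact ⟨x, hx, hlt⟩
  choose x hxD hx using hnear
  let L := ⨆ k, d k
  have hdist k j (hkj : k ≤ j) : dist (x k) (x j) ≤ √(2 * (L - d k) + 4 * (1 / ((k : ℝ) + 1))) := by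
    rw [dist_eq_norm]
    refine Real.le_sqrt_of_sq_le ?_
    have hjk : 1 / ((j : ℝ) + 1) ≤ 1 / ((k : ℝ) + 1) := by gcongr
    linarith [norm_sub_sq_le_of_convex (hconv k) (hd k) (hxD k) (hanti hkj (hxD j)), hx k, hx j,
      le_ciSup habove j]
  have hlim : Tendsto (fun k : ℕ => √(2 * (L - d k) + 4 * (1 / ((k : ℝ) + 1)))) atTop (𝓝 0) := by
    simpa [L] using ((((tendsto_atTop_ciSup hmono habove).const_sub L).const_mul 2).add
      (tendsto_one_div_add_atTop_nhds_zero_nat.const_mul 4)).sqrt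
  obtain ⟨l, hl⟩ := cauchySeq_tendsto_of_complete (cauchySeq_of_le_tendsto_0' _ hdist hlim)
  exact ⟨x, l, hxD, hl⟩

variable {Ω : Type*} [MeasurableSpace Ω]

lemma convex_setOf_exists_ae_eq (μ : Measure Ω) (p : ℝ≥0∞) {C : Set (Ω → ℝ)} (hC : Convex ℝ C) :
    Convex ℝ {x : Lp ℝ p μ | ∃ f ∈ C, x =ᵐ[μ] f} := by
  rintro x ⟨f, hf, hxf⟩ y ⟨g, hg, hyg⟩ a b ha hb hab
  refine ⟨a • f + b • g, hC hf hg ha hb hab, ?_⟩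
  exact (Lp.coeFn_add _ _).trans
    (((Lp.coeFn_smul a x).trans (hxf.const_smul a)).add
      ((Lp.coeFn_smul b y).trans (hyg.const_smul b)))

theorem exists_seq_ae_tendsto_of_antitone_convex (μ : Measure Ω) [IsFiniteMeasure μ]
    {C : ℕ → Set (Ω → ℝ)} (hanti : Antitone C) (hconv : ∀ k, Convex ℝ (C k))
    (hne : ∀ k, (C k).Nonempty) (hmeas : ∀ f ∈ C 0, Measurable f) {M : ℝ}
    (hM : ∀ f ∈ C 0, ∀ ω, ‖f ω‖ ≤ M) :
    ∃ (r : ℕ → Ω → ℝ) (g : Ω → ℝ), (∀ k, r k ∈ C k) ∧ Measurable g ∧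
      ∀ᵐ ω ∂μ, Tendsto (r · ω) atTop (𝓝 (g ω)) := by
  let D k : Set (Lp ℝ 2 μ) := {x | ∃ f ∈ C k, x =ᵐ[μ] f}
  have hDanti : Antitone D := fun j k hjk x ⟨f, hf, hxf⟩ => ⟨f, hanti hjk hf, hxf⟩
  have hDne k : (D k).Nonempty := by
    obtain ⟨f, hf⟩ := hne k
    have hf0 : f ∈ C 0 := hanti k.zero_le hf
    have hLp : MemLp f 2 μ :=
      .of_bound (hmeas f hf0).aestronglyMeasurable M (ae_of_all _ (hM f hf0))
    exact ⟨hLp.toLp f, f, hf, hLp.coeFn_toLp⟩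
  have hDbdd : Bornology.IsBounded (D 0) := by
    refine isBounded_iff_forall_norm_le.2
      ⟨measureUnivNNReal μ ^ (2 : ℝ≥0∞).toReal⁻¹ * max M 0, ?_⟩
    rintro x ⟨f, hf, hxf⟩
    refine Lp.norm_le_of_ae_bound (le_max_right _ _) ?_
    filter_upwards [hxf] with ω hω
    exact hω ▸ (hM f hf ω).trans (le_max_left _ _)
  obtain ⟨x, l, hxD, hl⟩ := exists_seq_tendsto_of_antitone_convex hDanti
    (fun k => convex_setOf_exists_ae_eq μ 2 (hconv k)) hDne hDbdd
  obtain ⟨φ, hφ, hae⟩ := (tendstoInMeasure_of_tendsto_Lp hl).exists_seq_tendsto_ae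
  choose f hfC hf using hxD
  refine ⟨fun k => f (φ k), l, fun k => hanti (hφ.id_le k) (hfC _),
    (Lp.stronglyMeasurable l).measurable, ?_⟩
  filter_upwards [hae, ae_all_iff.2 hf] with ω hω hfω
  simpa only [hfω] using hω

theorem isClosed_image_of_ae_tendsto {E : Type*} [AddCommMonoid E] [Module ℝ E]
    [TopologicalSpace E] [LocallyConvexSpace ℝ E] [FirstCountableTopology E] [T2Space E]
    (μ : Measure Ω) [IsFiniteMeasure μ] {K : Set (Ω → ℝ)} (hK : Convex ℝ K)
    (hmeas : ∀ f ∈ K, Measurable f) {M : ℝ} (hM : ∀ f ∈ K, ∀ ω, ‖f ω‖ ≤ M) {T : (Ω → ℝ) → E}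
    (hT : ∀ f ∈ K, ∀ g ∈ K, ∀ a b : ℝ, a + b = 1 → T (a • f + b • g) = a • T f + b • T g)
    (hlim : ∀ (r : ℕ → Ω → ℝ) (g : Ω → ℝ), (∀ k, r k ∈ K) → Measurable g →
      (∀ᵐ ω ∂μ, Tendsto (r · ω) atTop (𝓝 (g ω))) →
        ∃ q ∈ K, Tendsto (fun k => T (r k)) atTop (𝓝 (T q))) :
    IsClosed (T '' K) := by
  refine isClosed_of_closure_subset fun y hy => ?_
  obtain ⟨U, hU, hUbasis⟩ :=
    (LocallyConvexSpace.convex_basis (𝕜 := ℝ) y).exists_antitone_subbasis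
  let C k : Set (Ω → ℝ) := {f ∈ K | T f ∈ U k}
  have hanti : Antitone C := fun j k hjk f hf => ⟨hf.1, hUbasis.antitone hjk hf.2⟩
  have hconv k : Convex ℝ (C k) := fun f hf g hg a b ha hb hab =>
    ⟨hK hf.1 hg.1 ha hb hab, by
      rw [hT f hf.1 g hg.1 a b hab]; exact (hU k).2 hf.2 hg.2 ha hb hab⟩
  have hne k : (C k).Nonempty := by
    obtain ⟨_, hv, f, hf, rfl⟩ := mem_closure_iff_nhds.1 hy _ (hU k).1
    exact ⟨f, hf, hv⟩
  obtain ⟨r, g, hrC, hg, hrg⟩ := exists_seq_ae_tendsto_of_antitone_convex μ hanti hconv hne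
    (fun f hf => hmeas f hf.1) fun f hf => hM f hf.1
  obtain ⟨q, hq, hqlim⟩ := hlim r g (fun k => (hrC k).1) hg hrg
  exact ⟨q, hq, tendsto_nhds_unique hqlim (hUbasis.tendsto fun k => (hrC k).2)⟩

end Convexity

theorem exists_isSaddlePointOn_of_bilinear {E F : Type*}
    [AddCommGroup E] [Module ℝ E] [TopologicalSpace E] [IsTopologicalAddGroup E]
    [ContinuousSMul ℝ E] [AddCommGroup F] [Module ℝ F] [TopologicalSpace F]
    [IsTopologicalAddGroup F] [ContinuousSMul ℝ F] (b : E →ₗ[ℝ] F →ₗ[ℝ] ℝ)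
    (hb₁ : ∀ y, Continuous (b · y)) (hb₂ : ∀ x, Continuous (b x)) {X : Set E} {Y : Set F}
    (hXne : X.Nonempty) (hXconv : Convex ℝ X) (hX : IsCompact X)
    (hYne : Y.Nonempty) (hYconv : Convex ℝ Y) (hY : IsCompact Y) :
    ∃ x ∈ X, ∃ y ∈ Y, IsSaddlePointOn X Y (b · ·) x y :=
  Sion.exists_isSaddlePointOn hXne hXconv hX
    (fun y _ => (hb₁ y).lowerSemicontinuous.lowerSemicontinuousOn X)
    (fun y _ => ((b.flip y).convexOn hXconv).quasiconvexOn) hYconv hYne hY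
    (fun x _ => (hb₂ x).upperSemicontinuous.upperSemicontinuousOn Y)
    fun x _ => ((b x).concaveOn hYconv).quasiconcaveOn

section Normalize

variable {A Y : Type*} [Fintype A]

/-- The probability weights proportional to `r`; uniform weights if `r` vanishes. -/
def normalizedWeights (r : A → ℝ≥0) (a : A) : ℝ≥0 :=
  if ∑ b, r b = 0 then (Fintype.card A : ℝ≥0)⁻¹ else r a / ∑ b, r b

lemma sum_normalizedWeights [Nonempty A] (r : A → ℝ≥0) : ∑ a, normalizedWeights r a = 1 := by
  unfold normalizedWeights
  split_ifs with h
  · simp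
  · rw [← Finset.sum_div, div_self h]

lemma sum_mul_normalizedWeights (r : A → ℝ≥0) (a : A) :
    (∑ b, r b) * normalizedWeights r a = r a := by
  unfold normalizedWeights
  split_ifs with h
  · rw [h, zero_mul, Finset.sum_eq_zero_iff.1 h a (Finset.mem_univ a)]
  · exact mul_div_cancel₀ _ h

variable [MeasurableSpace A] [DiscreteMeasurableSpace A] [MeasurableSpace Y] {r : Y → A → ℝ≥0}

lemma measurable_uncurry_normalizedWeights (hr : ∀ a, Measurable (r · a)) :
    Measurable (Function.uncurry fun y => normalizedWeights (r y)) := by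
  have hsum : Measurable fun y => ∑ b, r y b := Finset.measurable_sum _ fun b _ => hr b
  exact measurable_from_prod_countable_left fun a =>
    .ite (hsum (measurableSet_singleton 0)) measurable_const ((hr a).div hsum)

/-- The kernel choosing a point of the finite type `A` with probability proportional to `r y`. As
for `Kernel.withDensity`, this is meaningful only if the weights depend measurably on `y`. -/
def proportionalKernel (r : Y → A → ℝ≥0) : Kernel Y A :=
  (Kernel.const Y Measure.count).withDensity fun y a => normalizedWeights (r y) a

lemma proportionalKernel_singleton (hr : ∀ a, Measurable (r · a)) (y : Y) (a : A) :
    proportionalKernel r y {a} = normalizedWeights (r y) a := by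
  rw [proportionalKernel, Kernel.withDensity_apply' _
    (measurable_uncurry_normalizedWeights hr).coe_nnreal_ennreal]
  simp

lemma isMarkovKernel_proportionalKernel [Nonempty A] (hr : ∀ a, Measurable (r · a)) :
    IsMarkovKernel (proportionalKernel r) := by
  refine ⟨fun y => ⟨?_⟩⟩
  rw [← Finset.coe_univ, ← sum_measure_singleton]
  simp only [proportionalKernel_singleton hr]
  exact_mod_cast sum_normalizedWeights (r y)

end Normalize

namespace PursuitEvasionGame

section OnePlayer

variable {A S B : Type*} [MeasurableSpace A] [MeasurableSpace S]
  (π : B → A) (p : ∀ n : ℕ, (Fin n → B) → ProbabilityMeasure S)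

/-- The conditional law of the private history of one player given the public history `h`. The
player reads its own action off a pair of actions by `π` and draws its signals from `p`; since the
signals are conditionally independent, no strategy enters. -/
def privLaw : ∀ n : ℕ, (Fin n → B) → Measure (Fin n → A × S)
  | 0, _ => Measure.dirac Fin.elim0
  | n + 1, h => ((privLaw n (Fin.init h)).prod (p (n + 1) h : Measure S)).map
      fun x => Fin.snoc x.1 (π (h (Fin.last n)), x.2)

lemma measurable_snoc_signal (a : A) (n : ℕ) :
    Measurable fun x : (Fin n → A × S) × S => (Fin.snoc x.1 (a, x.2) : Fin (n + 1) → A × S) :=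
  measurable_fin_snoc measurable_fst (measurable_const.prodMk measurable_snd)

instance isProbabilityMeasure_privLaw (n : ℕ) (h : Fin n → B) :
    IsProbabilityMeasure (privLaw π p n h) := by
  induction n with
  | zero => unfold privLaw; infer_instance
  | succ n ih =>
    have := ih (Fin.init h)
    exact Measure.isProbabilityMeasure_map (measurable_snoc_signal _ n).aemeasurable

lemma lintegral_privLaw_succ {n : ℕ} (h : Fin (n + 1) → B) {g : (Fin (n + 1) → A × S) → ℝ≥0∞}
    (hg : Measurable g) :
    ∫⁻ z, g z ∂privLaw π p (n + 1) h =
      ∫⁻ z, ∫⁻ s, g (Fin.snoc z (π (h (Fin.last n)), s)) ∂(p (n + 1) h : Measure S)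
        ∂privLaw π p n (Fin.init h) := by
  rw [privLaw, lintegral_map hg (measurable_snoc_signal _ n), lintegral_prod]
  exact (hg.comp (measurable_snoc_signal _ n)).aemeasurable

lemma map_init_privLaw {n : ℕ} (h : Fin (n + 1) → B) :
    (privLaw π p (n + 1) h).map (fun z => (Fin.init z : Fin n → A × S)) =
      privLaw π p n (Fin.init h) := by
  rw [privLaw, Measure.map_map measurable_fin_init (measurable_snoc_signal _ n)]
  simp only [Function.comp_def, Fin.init_snoc]
  rw [← Measure.fst, Measure.fst_prod]

lemma ae_privLaw_succ_of_ae_init {n : ℕ} (h : Fin (n + 1) → B) {P : (Fin n → A × S) → Prop}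
    (hP : ∀ᵐ z ∂privLaw π p n (Fin.init h), P z) :
    ∀ᵐ z ∂privLaw π p (n + 1) h, P (Fin.init z) :=
  ae_of_ae_map measurable_fin_init.aemeasurable ((map_init_privLaw π p h).symm ▸ hP)

variable (σ : BehavioralStrategy A S)

/-- The product of the probabilities that the strategy `σ` gives to the successive actions of a
private history. -/
def reachWeight : ∀ n : ℕ, (Fin n → A × S) → ℝ≥0∞
  | 0, _ => 1
  | n + 1, z => reachWeight n (Fin.init z) * σ.act n (Fin.init z) {(z (Fin.last n)).1}

lemma reachWeight_le_one (n : ℕ) (z : Fin n → A × S) : reachWeight σ n z ≤ 1 := by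
  induction n with
  | zero => exact le_rfl
  | succ n ih => exact mul_le_one' (ih _) prob_le_one

lemma reachWeight_mul_act_le_one (n : ℕ) (z : Fin n → A × S) (a : A) :
    reachWeight σ n z * σ.act n z {a} ≤ 1 :=
  mul_le_one' (reachWeight_le_one σ n z) prob_le_one

/-- The realization weight of a public history: the probability that the player using `σ` plays its
part of `h`, provided that the opponent plays the other part. -/
def realization (n : ℕ) (h : Fin n → B) : ℝ≥0∞ :=
  ∫⁻ z, reachWeight σ n z ∂privLaw π p n h

lemma realization_zero (h : Fin 0 → B) : realization π p σ 0 h = 1 := by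
  simp [realization, reachWeight]

lemma realization_le_one (n : ℕ) (h : Fin n → B) : realization π p σ n h ≤ 1 :=
  (lintegral_mono (reachWeight_le_one σ n)).trans (by simp)

variable [DiscreteMeasurableSpace A] [Countable A]

lemma measurable_reachWeight (n : ℕ) : Measurable (reachWeight σ n) := by
  induction n with
  | zero => exact measurable_const
  | succ n ih =>
    exact (ih.comp measurable_fin_init).mul ((measurable_kernel_singleton (σ.act n)).comp
      (measurable_fin_init.prodMk (measurable_fst.comp (measurable_pi_apply (Fin.last n)))))

lemma lintegral_reachWeight_succ {n : ℕ} (h : Fin (n + 1) → B)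
    {g : (Fin (n + 1) → A × S) → ℝ≥0∞} (hg : Measurable g) :
    ∫⁻ z, reachWeight σ (n + 1) z * g z ∂privLaw π p (n + 1) h =
      ∫⁻ z, reachWeight σ n z * (σ.act n z {π (h (Fin.last n))} *
        ∫⁻ s, g (Fin.snoc z (π (h (Fin.last n)), s)) ∂(p (n + 1) h : Measure S))
        ∂privLaw π p n (Fin.init h) := by
  refine (lintegral_privLaw_succ π p h ((measurable_reachWeight σ _).mul hg)).trans
    (lintegral_congr fun z => ?_)
  simp only [Pi.mul_apply, reachWeight, Fin.init_snoc, Fin.snoc_last]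
  rw [lintegral_const_mul, mul_assoc]
  exact hg.comp ((measurable_snoc_signal _ n).comp measurable_prodMk_left)

lemma realization_succ (n : ℕ) (h : Fin (n + 1) → B) :
    realization π p σ (n + 1) h =
      ∫⁻ z, reachWeight σ n z * σ.act n z {π (h (Fin.last n))} ∂privLaw π p n (Fin.init h) := by
  simpa [realization] using
    lintegral_reachWeight_succ π p σ h (g := fun _ => 1) measurable_const

end OnePlayer

section Snoc

variable {A₁ A₂ S₁ S₂ : Type*} {n : ℕ} (z : Fin n → Stage A₁ A₂ S₁ S₂) (x : Stage A₁ A₂ S₁ S₂)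

lemma hist_snoc : hist (Fin.snoc z x : Fin (n + 1) → _) = Fin.snoc (hist z) x.1 := by
  funext i
  refine Fin.lastCases ?_ (fun j => ?_) i <;> simp [hist]

lemma priv₁_snoc :
    priv₁ (Fin.snoc z x : Fin (n + 1) → _) = Fin.snoc (priv₁ z) (x.1.1, x.2.1) := by
  funext i
  refine Fin.lastCases ?_ (fun j => ?_) i <;> simp [priv₁]

lemma priv₂_snoc :
    priv₂ (Fin.snoc z x : Fin (n + 1) → _) = Fin.snoc (priv₂ z) (x.1.2, x.2.2) := by
  funext i
  refine Fin.lastCases ?_ (fun j => ?_) i <;> simp [priv₂]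

lemma measurable_hist [MeasurableSpace A₁] [MeasurableSpace A₂] [MeasurableSpace S₁]
    [MeasurableSpace S₂] (n : ℕ) :
    Measurable (hist : (Fin n → Stage A₁ A₂ S₁ S₂) → Fin n → A₁ × A₂) := by
  unfold hist; fun_prop

lemma actionKernel_singleton {A₁ A₂ S₁ S₂ : Type*} [MeasurableSpace A₁] [MeasurableSpace A₂]
    [MeasurableSpace S₁] [MeasurableSpace S₂] (σ₁ : BehavioralStrategy A₁ S₁)
    (σ₂ : BehavioralStrategy A₂ S₂) {n : ℕ} (z : Fin n → Stage A₁ A₂ S₁ S₂) (a : A₁ × A₂) :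
    actionKernel σ₁ σ₂ n z {a} = σ₁.act n (priv₁ z) {a.1} * σ₂.act n (priv₂ z) {a.2} := by
  rw [actionKernel, Kernel.prod_apply, Kernel.comap_apply, Kernel.comap_apply,
    ← Measure.prod_prod, Set.singleton_prod_singleton]

end Snoc

section Play

variable {A₁ A₂ S₁ S₂ : Type*}
  [MeasurableSpace A₁] [DiscreteMeasurableSpace A₁] [Finite A₁]
  [MeasurableSpace A₂] [DiscreteMeasurableSpace A₂] [Finite A₂]
  [MeasurableSpace S₁] [MeasurableSpace S₂]
  (G : PursuitEvasionGame A₁ A₂ S₁ S₂)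
  (σ₁ : BehavioralStrategy A₁ S₁) (σ₂ : BehavioralStrategy A₂ S₂) {n : ℕ}

instance isProbabilityMeasure_playMeasure : IsProbabilityMeasure (G.playMeasure σ₁ σ₂) := by
  unfold playMeasure; infer_instance

/-- The law of the first `n` stages. -/
def prefixLaw (n : ℕ) : Measure (Fin n → Stage A₁ A₂ S₁ S₂) :=
  (G.playMeasure σ₁ σ₂).map fun z i => z i

lemma measurable_prefix {X : Type*} [MeasurableSpace X] (n : ℕ) :
    Measurable fun (z : ℕ → X) (i : Fin n) => z i :=
  measurable_pi_lambda _ fun _ => measurable_pi_apply _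

instance isProbabilityMeasure_prefixLaw (n : ℕ) : IsProbabilityMeasure (G.prefixLaw σ₁ σ₂ n) :=
  Measure.isProbabilityMeasure_map (measurable_prefix n).aemeasurable

lemma playMeasure_map_eval_zero :
    (G.playMeasure σ₁ σ₂).map (fun z => z 0) = G.stageKernel σ₁ σ₂ 0 Fin.elim0 := by
  have h : (fun z : ℕ → Stage A₁ A₂ S₁ S₂ => z 0) =
      (fun x : (Finset.Iic 0 → Stage A₁ A₂ S₁ S₂) => x ⟨0, by simp⟩) ∘
        Preorder.frestrictLe (π := fun _ => Stage A₁ A₂ S₁ S₂) 0 := rfl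
  rw [h, ← Measure.map_map (measurable_pi_apply _) (by fun_prop), playMeasure,
    Kernel.trajMeasure, Measure.map_comp _ _ (by fun_prop), Kernel.traj_map_frestrictLe,
    Kernel.partialTraj_self, Measure.id_comp, Measure.map_map (measurable_pi_apply _) (by fun_prop)]
  exact Measure.map_id

lemma map_prefix_eval_playMeasure (n : ℕ) :
    (G.playMeasure σ₁ σ₂).map (fun z => ((fun i : Fin n => z i), z n)) =
      G.prefixLaw σ₁ σ₂ n ⊗ₘ G.stageKernel σ₁ σ₂ n := by
  cases n with
  | zero =>
    have hdirac : G.prefixLaw σ₁ σ₂ 0 = Measure.dirac Fin.elim0 := by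
      have hconst : (fun (z : ℕ → Stage A₁ A₂ S₁ S₂) (i : Fin 0) => z i) = fun _ => Fin.elim0 :=
        funext fun _ => Subsingleton.elim _ _
      rw [prefixLaw, hconst, Measure.map_const, measure_univ, one_smul]
    ext s hs
    rw [hdirac, Measure.dirac_compProd_apply hs, ← playMeasure_map_eval_zero,
      Measure.map_apply (by fun_prop) hs, Measure.map_apply (by fun_prop)
        (measurable_prodMk_left hs)]
    congr! 1
    ext z
    simp [Subsingleton.elim _ (Fin.elim0 : Fin 0 → Stage A₁ A₂ S₁ S₂)]
  | succ n =>
    let r : (Finset.Iic n → Stage A₁ A₂ S₁ S₂) → Fin (n + 1) → Stage A₁ A₂ S₁ S₂ :=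
      fun x i => x ⟨(i : ℕ), Finset.mem_Iic.2 (Nat.le_of_lt_succ i.isLt)⟩
    have hr : Measurable r := measurable_pi_lambda _ fun _ => measurable_pi_apply _
    have hres : Measurable (Preorder.frestrictLe (π := fun _ => Stage A₁ A₂ S₁ S₂) n) := by fun_prop
    have hprefix : G.prefixLaw σ₁ σ₂ (n + 1) =
        ((G.playMeasure σ₁ σ₂).map (Preorder.frestrictLe n)).map r :=
      (Measure.map_map hr hres).symm
    have hstep : (G.playMeasure σ₁ σ₂).map (Preorder.frestrictLe n) ⊗ₘ G.stepKernel σ₁ σ₂ n =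
        (G.playMeasure σ₁ σ₂).map fun z => (Preorder.frestrictLe n z, z (n + 1)) :=
      Kernel.map_frestrictLe_trajMeasure_compProd_eq_map_trajMeasure
    rw [hprefix, map_compProd_eq_compProd_comap _ hr]
    refine .trans ?_ (congrArg (Measure.map _) hstep.symm)
    exact (Measure.map_map (hr.prodMap measurable_id) (hres.prodMk (measurable_pi_apply _))).symm

lemma prefixLaw_succ (n : ℕ) :
    G.prefixLaw σ₁ σ₂ (n + 1) = (G.prefixLaw σ₁ σ₂ n ⊗ₘ G.stageKernel σ₁ σ₂ n).map
      fun x => Fin.snoc x.1 x.2 := by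
  rw [← map_prefix_eval_playMeasure, Measure.map_map
    (measurable_fin_snoc measurable_fst measurable_snd) (by fun_prop), prefixLaw]
  congr! 1
  funext z
  exact (Fin.snoc_init_self fun i : Fin (n + 1) => z i).symm

lemma setLIntegral_prefixLaw_succ (h : Fin (n + 1) → A₁ × A₂)
    {g : (Fin (n + 1) → Stage A₁ A₂ S₁ S₂) → ℝ≥0∞} (hg : Measurable g) :
    ∫⁻ z in hist ⁻¹' {h}, g z ∂G.prefixLaw σ₁ σ₂ (n + 1) =
      ∫⁻ z in hist ⁻¹' {Fin.init h}, ∫⁻ x in {h (Fin.last n)} ×ˢ Set.univ, g (Fin.snoc z x)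
        ∂G.stageKernel σ₁ σ₂ n z ∂G.prefixLaw σ₁ σ₂ n := by
  have hsnoc : Measurable fun x : (Fin n → Stage A₁ A₂ S₁ S₂) × Stage A₁ A₂ S₁ S₂ =>
      (Fin.snoc x.1 x.2 : Fin (n + 1) → _) := measurable_fin_snoc measurable_fst measurable_snd
  have hpre : (fun x : (Fin n → Stage A₁ A₂ S₁ S₂) × Stage A₁ A₂ S₁ S₂ =>
      (Fin.snoc x.1 x.2 : Fin (n + 1) → _)) ⁻¹' (hist ⁻¹' {h}) =
        (hist ⁻¹' {Fin.init h}) ×ˢ ({h (Fin.last n)} ×ˢ Set.univ) := by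
    ext x
    obtain ⟨h, a, rfl⟩ : ∃ h' a, h = Fin.snoc h' a := ⟨_, _, (Fin.snoc_init_self h).symm⟩
    simp [hist_snoc]
  rw [prefixLaw_succ, setLIntegral_map (measurable_hist _ (.singleton h)) hg hsnoc, hpre]
  exact Measure.setLIntegral_compProd (hg.comp hsnoc) (measurable_hist _ (.singleton _))
    ((MeasurableSet.singleton _).prod .univ)

lemma setLIntegral_stageKernel (z : Fin n → Stage A₁ A₂ S₁ S₂) (a : A₁ × A₂)
    {g : Stage A₁ A₂ S₁ S₂ → ℝ≥0∞} (hg : Measurable g) :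
    ∫⁻ x in {a} ×ˢ Set.univ, g x ∂G.stageKernel σ₁ σ₂ n z =
      σ₁.act n (priv₁ z) {a.1} * σ₂.act n (priv₂ z) {a.2} *
        ∫⁻ s, g (a, s) ∂G.signalKernel (n + 1) (Fin.snoc (hist z) a) := by
  rw [stageKernel, Kernel.setLIntegral_compProd_univ_right _ _ _ hg (.singleton a),
    lintegral_singleton, actionKernel_singleton, mul_comm]
  rfl

lemma setLIntegral_stageKernel_mul (h : Fin (n + 1) → A₁ × A₂) {z : Fin n → Stage A₁ A₂ S₁ S₂}
    (hz : hist z = Fin.init h)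
    {g₁ : (Fin (n + 1) → A₁ × S₁) → ℝ≥0∞} (hg₁ : Measurable g₁)
    {g₂ : (Fin (n + 1) → A₂ × S₂) → ℝ≥0∞} (hg₂ : Measurable g₂) :
    ∫⁻ x in {h (Fin.last n)} ×ˢ Set.univ, g₁ (priv₁ (Fin.snoc z x : Fin (n + 1) → _)) *
        g₂ (priv₂ (Fin.snoc z x : Fin (n + 1) → _)) ∂G.stageKernel σ₁ σ₂ n z =
      (σ₁.act n (priv₁ z) {(h (Fin.last n)).1} *
        ∫⁻ s, g₁ (Fin.snoc (priv₁ z) ((h (Fin.last n)).1, s)) ∂(G.p₁ (n + 1) h : Measure S₁)) *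
      (σ₂.act n (priv₂ z) {(h (Fin.last n)).2} *
        ∫⁻ s, g₂ (Fin.snoc (priv₂ z) ((h (Fin.last n)).2, s)) ∂(G.p₂ (n + 1) h : Measure S₂)) := by
  have hsnoc : Measurable fun x : Stage A₁ A₂ S₁ S₂ => (Fin.snoc z x : Fin (n + 1) → _) :=
    measurable_fin_snoc measurable_const measurable_id
  have hm : Measurable fun x : Stage A₁ A₂ S₁ S₂ => g₁ (priv₁ (Fin.snoc z x : Fin (n + 1) → _)) *
      g₂ (priv₂ (Fin.snoc z x : Fin (n + 1) → _)) :=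
    (hg₁.comp ((measurable_priv₁ _).comp hsnoc)).mul (hg₂.comp ((measurable_priv₂ _).comp hsnoc))
  rw [setLIntegral_stageKernel _ _ _ _ _ hm, hz, Fin.snoc_init_self]
  have hm₁ : Measurable fun s => g₁ (Fin.snoc (priv₁ z) ((h (Fin.last n)).1, s)) :=
    hg₁.comp (measurable_fin_snoc measurable_const measurable_prodMk_left)
  have hm₂ : Measurable fun s => g₂ (Fin.snoc (priv₂ z) ((h (Fin.last n)).2, s)) :=
    hg₂.comp (measurable_fin_snoc measurable_const measurable_prodMk_left)
  have hsig : G.signalKernel (n + 1) h =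
    (G.p₁ (n + 1) h : Measure S₁).prod (G.p₂ (n + 1) h : Measure S₂) := rfl
  simp only [priv₁_snoc, priv₂_snoc]
  rw [hsig, lintegral_prod_mul hm₁.aemeasurable hm₂.aemeasurable]
  ring

/- Given the public history, the two private histories are independent, and the probability of the
public history is a product of one factor for each player. -/
theorem setLIntegral_prefixLaw_mul (n : ℕ) (h : Fin n → A₁ × A₂)
    {g₁ : (Fin n → A₁ × S₁) → ℝ≥0∞} (hg₁ : Measurable g₁)
    {g₂ : (Fin n → A₂ × S₂) → ℝ≥0∞} (hg₂ : Measurable g₂) :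
    ∫⁻ z in hist ⁻¹' {h}, g₁ (priv₁ z) * g₂ (priv₂ z) ∂G.prefixLaw σ₁ σ₂ n =
      (∫⁻ z, reachWeight σ₁ n z * g₁ z ∂privLaw Prod.fst G.p₁ n h) *
        ∫⁻ z, reachWeight σ₂ n z * g₂ z ∂privLaw Prod.snd G.p₂ n h := by
  induction n with
  | zero =>
    have hset : hist ⁻¹' {h} = (Set.univ : Set (Fin 0 → Stage A₁ A₂ S₁ S₂)) :=
      Set.eq_univ_of_forall fun z => Subsingleton.elim _ _
    simp [hset, privLaw, reachWeight, lintegral_dirac' _ hg₁, lintegral_dirac' _ hg₂,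
      Subsingleton.elim (priv₁ _) Fin.elim0, Subsingleton.elim (priv₂ _) Fin.elim0]
  | succ n ih =>
    have hm₁ : Measurable fun z : Fin n → A₁ × S₁ => σ₁.act n z {(h (Fin.last n)).1} *
        ∫⁻ s, g₁ (Fin.snoc z ((h (Fin.last n)).1, s)) ∂(G.p₁ (n + 1) h : Measure S₁) :=
      ((σ₁.act n).measurable_coe (.singleton _)).mul
        (hg₁.comp (measurable_snoc_signal _ n)).lintegral_prod_right'
    have hm₂ : Measurable fun z : Fin n → A₂ × S₂ => σ₂.act n z {(h (Fin.last n)).2} *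
        ∫⁻ s, g₂ (Fin.snoc z ((h (Fin.last n)).2, s)) ∂(G.p₂ (n + 1) h : Measure S₂) :=
      ((σ₂.act n).measurable_coe (.singleton _)).mul
        (hg₂.comp (measurable_snoc_signal _ n)).lintegral_prod_right'
    rw [lintegral_reachWeight_succ _ _ _ _ hg₁, lintegral_reachWeight_succ _ _ _ _ hg₂,
      ← ih (Fin.init h) hm₁ hm₂]
    refine (setLIntegral_prefixLaw_succ _ _ _ _ ((hg₁.comp (measurable_priv₁ _)).mul
      (hg₂.comp (measurable_priv₂ _)))).trans
      (setLIntegral_congr_fun (measurable_hist _ (.singleton _)) fun z hz => ?_)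
    exact setLIntegral_stageKernel_mul G σ₁ σ₂ h hz hg₁ hg₂

lemma prefixLaw_hist_preimage (n : ℕ) (h : Fin n → A₁ × A₂) :
    G.prefixLaw σ₁ σ₂ n (hist ⁻¹' {h}) =
      realization Prod.fst G.p₁ σ₁ n h * realization Prod.snd G.p₂ σ₂ n h := by
  simpa [realization] using setLIntegral_prefixLaw_mul G σ₁ σ₂ n h (g₁ := fun _ => 1)
    (g₂ := fun _ => 1) measurable_const measurable_const

lemma map_prefix_historyMeasure (n : ℕ) :
    (G.historyMeasure σ₁ σ₂).map (fun h (i : Fin n) => h i) = (G.prefixLaw σ₁ σ₂ n).map hist := by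
  rw [historyMeasure, prefixLaw, Measure.map_map (measurable_prefix n) (by fun_prop),
    Measure.map_map (measurable_hist n) (measurable_prefix n)]
  rfl

lemma lintegral_historyMeasure_prefix [Fintype A₁] [Fintype A₂] (n : ℕ)
    (f : (Fin n → A₁ × A₂) → ℝ≥0∞) :
    ∫⁻ h, f (fun i => h i) ∂G.historyMeasure σ₁ σ₂ =
      ∑ h, f h * (realization Prod.fst G.p₁ σ₁ n h * realization Prod.snd G.p₂ σ₂ n h) := by
  rw [← lintegral_map (f := f) (measurable_of_countable _) (measurable_prefix n),
    map_prefix_historyMeasure, lintegral_fintype]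
  refine Finset.sum_congr rfl fun h _ => ?_
  rw [Measure.map_apply (measurable_hist n) (.singleton h), prefixLaw_hist_preimage]

end Play

section Plans

/-- A finite sequence of elements of `B`; in the game, a public history of any length. -/
abbrev History (B : Type*) : Type _ := Σ n : ℕ, Fin n → B

/-- A private history together with an action that the player may take next. -/
abbrev Decision (A S : Type*) : Type _ := Σ n : ℕ, (Fin n → A × S) × A

variable {A S B : Type*} [MeasurableSpace A] [MeasurableSpace S]

lemma measurable_decision (n : ℕ) (a : A) :
    Measurable fun z : Fin n → A × S => (⟨n, z, a⟩ : Decision A S) :=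
  (measurable_sigma_mk n).comp measurable_prodMk_right

variable (π : B → A) (p : ∀ n : ℕ, (Fin n → B) → ProbabilityMeasure S)

/-- A realization plan: the player's own contribution to the probability of reaching a private
history and then taking an action. The flow equations hold only almost everywhere, so that
almost everywhere limits of plans are again plans. -/
structure IsPlan [Fintype A] (r : Decision A S → ℝ) : Prop where
  measurable : Measurable r
  mem_Icc : ∀ ω, r ω ∈ Set.Icc (0 : ℝ) 1
  sum_zero : ∀ z, ∑ a, r ⟨0, z, a⟩ = 1
  sum_succ : ∀ (n : ℕ) (h : Fin (n + 1) → B), ∀ᵐ z ∂privLaw π p (n + 1) h,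
    ∑ a, r ⟨n + 1, z, a⟩ = r ⟨n, Fin.init z, (z (Fin.last n)).1⟩

/-- The realization weights of all public histories under a realization plan. -/
def planVector (r : Decision A S → ℝ) : History B → ℝ
  | ⟨0, _⟩ => 1
  | ⟨n + 1, h⟩ => ∫ z, r ⟨n, z, π (h (Fin.last n))⟩ ∂privLaw π p n (Fin.init h)

/-- The realization weights of all public histories under a strategy, as real numbers. -/
def realizationVector (σ : BehavioralStrategy A S) (i : History B) : ℝ :=
  (realization π p σ i.1 i.2).toReal

/-- The set of realization vectors of the strategies of a player. -/
def realizationSet : Set (History B → ℝ) :=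
  Set.range (realizationVector (A := A) (S := S) π p)

/-- The realization plan of a strategy. -/
def strategyPlan (σ : BehavioralStrategy A S) (ω : Decision A S) : ℝ :=
  (reachWeight σ ω.1 ω.2.1 * σ.act ω.1 ω.2.1 {ω.2.2}).toReal

lemma ofReal_realizationVector (σ : BehavioralStrategy A S) (i : History B) :
    ENNReal.ofReal (realizationVector π p σ i) = realization π p σ i.1 i.2 :=
  ENNReal.ofReal_toReal ((realization_le_one π p σ i.1 i.2).trans_lt ENNReal.one_lt_top).ne

lemma realizationVector_mem_Icc (σ : BehavioralStrategy A S) (i : History B) :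
    realizationVector π p σ i ∈ Set.Icc (0 : ℝ) 1 :=
  ⟨ENNReal.toReal_nonneg,
    ENNReal.toReal_le_of_le_ofReal zero_le_one (by simpa using realization_le_one π p σ i.1 i.2)⟩

lemma realizationVector_zero (σ : BehavioralStrategy A S) (h : Fin 0 → B) :
    realizationVector π p σ ⟨0, h⟩ = 1 := by
  simp [realizationVector, realization_zero]

lemma planVector_strategyPlan [DiscreteMeasurableSpace A] [Countable A]
    (σ : BehavioralStrategy A S) :
    planVector π p (strategyPlan σ) = realizationVector π p σ := by
  ext ⟨n, h⟩
  cases n with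
  | zero => exact (realizationVector_zero π p σ h).symm
  | succ n =>
    rw [realizationVector, realization_succ]
    exact integral_toReal
      ((measurable_reachWeight σ n).mul
        ((σ.act n).measurable_coe (measurableSet_singleton _))).aemeasurable
      (ae_of_all _ fun z => (reachWeight_mul_act_le_one σ n z _).trans_lt ENNReal.one_lt_top)

/- Each of the countably many laws of decisions obtained from a public history and a next action is
absolutely continuous with respect to their sum. -/
lemma exists_finite_measure_forall_ae_privLaw [Countable A] [Countable B] :
    ∃ μ : Measure (Decision A S), IsFiniteMeasure μ ∧ ∀ P : Decision A S → Prop,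
      (∀ᵐ ω ∂μ, P ω) → ∀ (n : ℕ) (h : Fin n → B), ∀ᵐ z ∂privLaw π p n h, ∀ a, P ⟨n, z, a⟩ := by
  let ν (i : Σ n : ℕ, (Fin n → B) × A) : Measure (Decision A S) :=
    (privLaw π p i.1 i.2.1).map fun z => ⟨i.1, z, i.2.2⟩
  have : SFinite (Measure.sum ν) := inferInstance
  refine ⟨(Measure.sum ν).toFinite, inferInstance, fun P hP n h => ae_all_iff.2 fun a => ?_⟩
  have hν : ν ⟨n, h, a⟩ ≪ (Measure.sum ν).toFinite :=
    (Measure.absolutelyContinuous_sum_right (μs := ν) ⟨n, h, a⟩ .rfl).trans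
      (absolutelyContinuous_toFinite _)
  exact ae_of_ae_map (measurable_decision n a).aemeasurable (hν.ae_le hP)

section Fintype

variable {π p} [Fintype A] {r r' : Decision A S → ℝ}

namespace IsPlan

lemma norm_le_one (hr : IsPlan π p r) (ω : Decision A S) : ‖r ω‖ ≤ 1 := by
  rw [Real.norm_of_nonneg (hr.mem_Icc ω).1]
  exact (hr.mem_Icc ω).2

lemma integrable (hr : IsPlan π p r) (n : ℕ) (a : A) (h : Fin n → B) :
    Integrable (fun z => r ⟨n, z, a⟩) (privLaw π p n h) :=
  .of_bound (hr.measurable.comp (measurable_decision n a)).aestronglyMeasurable 1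
    (ae_of_all _ fun _ => hr.norm_le_one _)

lemma planVector_combination (hr : IsPlan π p r) (hr' : IsPlan π p r') {a b : ℝ}
    (hab : a + b = 1) :
    planVector π p (a • r + b • r') = a • planVector π p r + b • planVector π p r' := by
  ext ⟨n, h⟩
  cases n with
  | zero => simp [planVector, hab]
  | succ n =>
    simp only [planVector, Pi.add_apply, Pi.smul_apply, smul_eq_mul]
    rw [integral_add ((hr.integrable n _ _).const_mul a) ((hr'.integrable n _ _).const_mul b),
      integral_const_mul, integral_const_mul]

lemma of_tendsto {r : ℕ → Decision A S → ℝ} {q : Decision A S → ℝ} (hr : ∀ k, IsPlan π p (r k))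
    (hq : Measurable q) (hq_mem : ∀ ω, q ω ∈ Set.Icc (0 : ℝ) 1)
    (hlim : ∀ (n : ℕ) (h : Fin n → B), ∀ᵐ z ∂privLaw π p n h, ∀ a,
      Tendsto (r · ⟨n, z, a⟩) atTop (𝓝 (q ⟨n, z, a⟩))) :
    IsPlan π p q := by
  refine ⟨hq, hq_mem, fun z => ?_, fun n h => ?_⟩
  · have hz : ∀ a, Tendsto (r · ⟨0, z, a⟩) atTop (𝓝 (q ⟨0, z, a⟩)) := by
      have hdirac := hlim 0 Fin.elim0
      rw [privLaw, ae_dirac_iff (Set.subsingleton_of_subsingleton.measurableSet)] at hdirac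
      rwa [Subsingleton.elim z Fin.elim0]
    refine tendsto_nhds_unique (tendsto_finsetSum _ fun a _ => hz a) ?_
    simpa only [(hr _).sum_zero] using tendsto_const_nhds
  · filter_upwards [hlim (n + 1) h, ae_privLaw_succ_of_ae_init π p h (hlim n (Fin.init h)),
      ae_all_iff.2 fun k => (hr k).sum_succ n h] with z hz hz_init hsum
    refine tendsto_nhds_unique (tendsto_finsetSum _ fun a _ => hz a) ?_
    simpa only [hsum] using hz_init _

end IsPlan

lemma convex_setOf_isPlan : Convex ℝ {r : Decision A S → ℝ | IsPlan π p r} := by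
  intro r hr r' hr' a b ha hb hab
  refine ⟨(hr.measurable.const_smul a).add (hr'.measurable.const_smul b),
    fun ω => convex_Icc 0 1 (hr.mem_Icc ω) (hr'.mem_Icc ω) ha hb hab, fun z => ?_, fun n h => ?_⟩
  · simp only [Pi.add_apply, Pi.smul_apply, smul_eq_mul, Finset.sum_add_distrib,
      ← Finset.mul_sum, hr.sum_zero, hr'.sum_zero, mul_one, hab]
  · filter_upwards [hr.sum_succ n h, hr'.sum_succ n h] with z hz hz'
    simp only [Pi.add_apply, Pi.smul_apply, smul_eq_mul, Finset.sum_add_distrib,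
      ← Finset.mul_sum, hz, hz']

lemma tendsto_planVector {r : ℕ → Decision A S → ℝ} {q : Decision A S → ℝ}
    (hr : ∀ k, IsPlan π p (r k)) (hlim : ∀ (n : ℕ) (h : Fin n → B), ∀ᵐ z ∂privLaw π p n h, ∀ a,
      Tendsto (r · ⟨n, z, a⟩) atTop (𝓝 (q ⟨n, z, a⟩))) :
    Tendsto (fun k => planVector π p (r k)) atTop (𝓝 (planVector π p q)) := by
  refine tendsto_pi_nhds.2 ?_
  rintro ⟨n, h⟩
  cases n with
  | zero => exact tendsto_const_nhds
  | succ n =>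
    refine tendsto_integral_of_dominated_convergence (fun _ => 1)
      (fun k => ((hr k).integrable n _ _).aestronglyMeasurable) (integrable_const _)
      (fun k => ae_of_all _ fun z => (hr k).norm_le_one _) ?_
    filter_upwards [hlim n (Fin.init h)] with z hz using hz _

/- A limit of plans lies in `[0, 1]` only almost everywhere, so it is clamped. -/
lemma exists_isPlan_tendsto_planVector {r : ℕ → Decision A S → ℝ} {g : Decision A S → ℝ}
    (hr : ∀ k, IsPlan π p (r k)) (hg : Measurable g)
    (hlim : ∀ (n : ℕ) (h : Fin n → B), ∀ᵐ z ∂privLaw π p n h, ∀ a,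
      Tendsto (r · ⟨n, z, a⟩) atTop (𝓝 (g ⟨n, z, a⟩))) :
    ∃ q, IsPlan π p q ∧
      Tendsto (fun k => planVector π p (r k)) atTop (𝓝 (planVector π p q)) := by
  let q : Decision A S → ℝ := fun ω => max 0 (min 1 (g ω))
  have hqlim (n : ℕ) (h : Fin n → B) : ∀ᵐ z ∂privLaw π p n h, ∀ a,
      Tendsto (r · ⟨n, z, a⟩) atTop (𝓝 (q ⟨n, z, a⟩)) := by
    filter_upwards [hlim n h] with z hz a
    refine (tendsto_const_nhds.max (tendsto_const_nhds.min (hz a))).congr fun k => ?_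
    rw [min_eq_right ((hr k).mem_Icc _).2, max_eq_right ((hr k).mem_Icc _).1]
  have hq : IsPlan π p q :=
    .of_tendsto hr (measurable_const.max (measurable_const.min hg))
      (fun _ => ⟨le_max_left _ _, max_le zero_le_one (min_le_left _ _)⟩) hqlim
  exact ⟨q, hq, tendsto_planVector hr hqlim⟩

section Nonempty

variable [DiscreteMeasurableSpace A] [Nonempty A]

/-- The strategy that follows a realization plan, choosing actions with conditional probabilities
proportional to the plan. -/
def planStrategy (r : Decision A S → ℝ) (hr : Measurable r) : BehavioralStrategy A S where
  act n := proportionalKernel fun z a => (r ⟨n, z, a⟩).toNNReal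
  isMarkov n := isMarkovKernel_proportionalKernel fun a =>
    (hr.comp (measurable_decision n a)).real_toNNReal

lemma sum_mul_act_planStrategy (hr : IsPlan π p r) (n : ℕ) (z : Fin n → A × S) (a : A) :
    ENNReal.ofReal (∑ b, r ⟨n, z, b⟩) * (planStrategy r hr.measurable).act n z {a} =
      ENNReal.ofReal (r ⟨n, z, a⟩) := by
  have hmeas b : Measurable fun z => (r ⟨n, z, b⟩).toNNReal :=
    (hr.measurable.comp (measurable_decision n b)).real_toNNReal
  rw [ENNReal.ofReal_sum_of_nonneg fun b _ => (hr.mem_Icc _).1, planStrategy,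
    proportionalKernel_singleton hmeas]
  simp only [ENNReal.ofReal]
  exact_mod_cast sum_mul_normalizedWeights (fun b => (r ⟨n, z, b⟩).toNNReal) a

lemma ae_reachWeight_mul_act_planStrategy (hr : IsPlan π p r) (n : ℕ) (h : Fin n → B) :
    ∀ᵐ z ∂privLaw π p n h, ∀ a, reachWeight (planStrategy r hr.measurable) n z *
      (planStrategy r hr.measurable).act n z {a} = ENNReal.ofReal (r ⟨n, z, a⟩) := by
  induction n with
  | zero =>
    refine ae_of_all _ fun z a => ?_
    rw [← sum_mul_act_planStrategy hr, hr.sum_zero, ENNReal.ofReal_one, reachWeight]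
  | succ n ih =>
    filter_upwards [ae_privLaw_succ_of_ae_init π p h (ih (Fin.init h)), hr.sum_succ n h]
      with z hreach hsum a
    rw [← sum_mul_act_planStrategy hr, hsum, ← hreach, reachWeight]

lemma realizationVector_planStrategy (hr : IsPlan π p r) :
    realizationVector π p (planStrategy r hr.measurable) = planVector π p r := by
  ext ⟨n, h⟩
  cases n with
  | zero => exact realizationVector_zero π p _ h
  | succ n =>
    rw [realizationVector, realization_succ, planVector,
      integral_eq_lintegral_of_nonneg_ae (ae_of_all _ fun z => (hr.mem_Icc _).1)
        (hr.integrable n _ _).aestronglyMeasurable]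
    congr 1
    refine lintegral_congr_ae ?_
    filter_upwards [ae_reachWeight_mul_act_planStrategy hr n (Fin.init h)] with z hz using hz _

end Nonempty

variable [DiscreteMeasurableSpace A]

lemma sum_strategyPlan (σ : BehavioralStrategy A S) (n : ℕ) (z : Fin n → A × S) :
    ∑ a, strategyPlan σ ⟨n, z, a⟩ = (reachWeight σ n z).toReal := by
  have hact : ∑ a, (σ.act n z {a}).toReal = 1 :=
    (sum_measureReal_singleton Finset.univ).trans (by simp)
  simp only [strategyPlan, ENNReal.toReal_mul, ← Finset.mul_sum, hact, mul_one]

lemma isPlan_strategyPlan (σ : BehavioralStrategy A S) : IsPlan π p (strategyPlan σ) where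
  measurable := measurable_of_sigma fun n =>
    (((measurable_reachWeight σ n).comp measurable_fst).mul
      (measurable_kernel_singleton (σ.act n))).ennreal_toReal
  mem_Icc ω := ⟨ENNReal.toReal_nonneg, ENNReal.toReal_le_of_le_ofReal zero_le_one
    (by simpa using reachWeight_mul_act_le_one σ ω.1 ω.2.1 ω.2.2)⟩
  sum_zero z := by simp [sum_strategyPlan, reachWeight]
  sum_succ n h := ae_of_all _ fun z => by rw [sum_strategyPlan, reachWeight, strategyPlan]

end Fintype

variable [DiscreteMeasurableSpace A] [Finite A] [Nonempty A]

lemma realizationSet_nonempty : (realizationSet (A := A) (S := S) π p).Nonempty := by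
  cases nonempty_fintype A
  exact ⟨_, planStrategy (fun _ => 0) measurable_const, rfl⟩

lemma realizationSet_eq_image [Fintype A] :
    realizationSet π p = planVector π p '' {r | IsPlan π p r} := by
  refine Set.Subset.antisymm ?_ ?_
  · rintro _ ⟨σ, rfl⟩
    exact ⟨strategyPlan σ, isPlan_strategyPlan σ, planVector_strategyPlan π p σ⟩
  · rintro _ ⟨r, hr, rfl⟩
    exact ⟨planStrategy r hr.measurable, realizationVector_planStrategy hr⟩

lemma convex_realizationSet : Convex ℝ (realizationSet π p) := by
  cases nonempty_fintype A
  rw [realizationSet_eq_image]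
  rintro _ ⟨r, hr, rfl⟩ _ ⟨r', hr', rfl⟩ a b ha hb hab
  exact ⟨a • r + b • r', convex_setOf_isPlan hr hr' ha hb hab, hr.planVector_combination hr' hab⟩

theorem isCompact_realizationSet [Countable B] : IsCompact (realizationSet π p) := by
  cases nonempty_fintype A
  obtain ⟨μ, hμ, hae⟩ := exists_finite_measure_forall_ae_privLaw π p
  have hclosed : IsClosed (realizationSet π p) := by
    rw [realizationSet_eq_image]
    exact isClosed_image_of_ae_tendsto μ convex_setOf_isPlan (fun r hr => hr.measurable)
      (fun r hr => hr.norm_le_one) (fun r hr r' hr' a b hab => hr.planVector_combination hr' hab)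
      fun r g hr hg hlim => exists_isPlan_tendsto_planVector hr hg (hae _ hlim)
  have hbox : IsCompact (Set.univ.pi fun _ : History B => Set.Icc (0 : ℝ) 1) :=
    isCompact_univ_pi fun _ => isCompact_Icc
  refine hbox.of_isClosed_subset hclosed ?_
  rintro _ ⟨σ, rfl⟩ i -
  exact realizationVector_mem_Icc π p σ i

end Plans

section Value

variable {A₁ A₂ S₁ S₂ : Type*}
  [MeasurableSpace A₁] [DiscreteMeasurableSpace A₁] [Finite A₁]
  [MeasurableSpace A₂] [DiscreteMeasurableSpace A₂] [Finite A₂]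
  [MeasurableSpace S₁] [MeasurableSpace S₂]
  (G : PursuitEvasionGame A₁ A₂ S₁ S₂) {ε : ℝ≥0} {v : ℝ≥0}
  (σ₁ : BehavioralStrategy A₁ S₁) (σ₂ : BehavioralStrategy A₂ S₂)

instance isProbabilityMeasure_historyMeasure : IsProbabilityMeasure (G.historyMeasure σ₁ σ₂) :=
  Measure.isProbabilityMeasure_map (by fun_prop : Measurable
    fun (z : ℕ → Stage A₁ A₂ S₁ S₂) n => (z n).1).aemeasurable

lemma lowerVal_le_upperVal : G.lowerVal ≤ G.upperVal :=
  iSup_iInf_le_iInf_iSup _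

variable {G σ₁ σ₂}

lemma isValue_of_le (h₁ : v ≤ G.val₁ σ₁) (h₂ : G.val₂ σ₂ ≤ v) : G.IsValue v := by
  have hl : v ≤ G.lowerVal := h₁.trans (le_iSup G.val₁ σ₁)
  have hu : G.upperVal ≤ v := (iInf_le G.val₂ σ₂).trans h₂
  have hlu := G.lowerVal_le_upperVal
  exact ⟨(hlu.trans hu).antisymm hl, hu.antisymm (hl.trans hlu)⟩

lemma isEpsOptimal₁_of_lt (hv : G.IsValue v) (hε : 0 < ε) (h : v < G.val₁ σ₁ + ε) :
    G.IsEpsOptimal₁ ε σ₁ :=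
  ⟨v, hv, ((le_iSup G.val₁ σ₁).trans_eq hv.1).trans_lt
    (ENNReal.lt_add_right ENNReal.coe_ne_top (by simpa using hε.ne')), h⟩

lemma isEpsOptimal₂_of_lt (hv : G.IsValue v) (hε : 0 < ε) (h : G.val₂ σ₂ < v + ε) :
    G.IsEpsOptimal₂ ε σ₂ :=
  ⟨v, hv, h, (hv.2.ge.trans (iInf_le G.val₂ σ₂)).trans_lt
    (ENNReal.lt_add_right h.ne_top (by simpa using hε.ne'))⟩

lemma lowerVal_ne_top_of_isBounded [Nonempty A₂] (hG : G.IsBounded) : G.lowerVal ≠ ⊤ := by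
  obtain ⟨b, hb⟩ := hG
  obtain ⟨_, σ₂, _⟩ := realizationSet_nonempty (A := A₂) Prod.snd G.p₂
  have hle (σ₁ : BehavioralStrategy A₁ S₁) : G.expectedPayoff σ₁ σ₂ ≤ b :=
    (lintegral_mono fun h => (hb h).le).trans (by simp)
  exact ((iSup_le fun σ₁ => (iInf_le _ σ₂).trans (hle σ₁)).trans_lt ENNReal.coe_lt_top).ne

end Value

section Payoff

variable {A₁ A₂ S₁ S₂ : Type*} [MeasurableSpace S₁] [MeasurableSpace S₂]
  (G : PursuitEvasionGame A₁ A₂ S₁ S₂) (h : ℕ → A₁ × A₂)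

lemma payoff_truncate (n : ℕ) :
    (G.truncate n).payoff h =
      ∑ m ∈ Finset.range (n + 1), (G.f m (fun i : Fin m => h i) : ℝ≥0∞) := by
  rw [payoff, tsum_eq_sum (s := Finset.range (n + 1)) fun m hm => by
    simp [truncate, mt Nat.lt_succ_of_le (by simpa using hm)]]
  exact Finset.sum_congr rfl fun m hm => by
    simp [truncate, Nat.le_of_lt_succ (Finset.mem_range.1 hm)]

lemma payoff_truncate_mono : Monotone fun n => (G.truncate n).payoff h := by
  intro m n hmn
  simp only [payoff_truncate]
  gcongr

lemma payoff_eq_iSup_truncate :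
    G.payoff h = ⨆ n, (G.truncate n).payoff h := by
  simp only [payoff_truncate]
  exact ENNReal.tsum_eq_iSup_nat' (tendsto_add_atTop_nat 1)

end Payoff

section Truncate

variable {A₁ A₂ S₁ S₂ : Type*}
  [MeasurableSpace A₁] [DiscreteMeasurableSpace A₁] [Finite A₁]
  [MeasurableSpace A₂] [DiscreteMeasurableSpace A₂] [Finite A₂]
  [MeasurableSpace S₁] [MeasurableSpace S₂]
  (G : PursuitEvasionGame A₁ A₂ S₁ S₂)
  (σ₁ : BehavioralStrategy A₁ S₁) (σ₂ : BehavioralStrategy A₂ S₂)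

lemma measurable_dailyPayoff (n : ℕ) :
    Measurable fun h : ℕ → A₁ × A₂ => (G.f n (fun i : Fin n => h i) : ℝ≥0∞) :=
  (measurable_of_countable fun h => (G.f n h : ℝ≥0∞)).comp (measurable_prefix n)

lemma expectedPayoff_eq_iSup_truncate :
    G.expectedPayoff σ₁ σ₂ = ⨆ n, (G.truncate n).expectedPayoff σ₁ σ₂ := by
  simp only [expectedPayoff, payoff_eq_iSup_truncate G]
  refine lintegral_iSup (fun n => ?_) fun m n hmn h => G.payoff_truncate_mono h hmn
  rw [funext (payoff_truncate G · n)]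
  exact Finset.measurable_fun_sum _ fun m _ => G.measurable_dailyPayoff m

lemma expectedPayoff_truncate_mono : Monotone fun n => (G.truncate n).expectedPayoff σ₁ σ₂ :=
  fun _ _ hmn => lintegral_mono fun h => G.payoff_truncate_mono h hmn

lemma val₁_truncate_mono : Monotone fun n => (G.truncate n).val₁ σ₁ :=
  fun _ _ hmn => iInf_mono fun σ₂ => G.expectedPayoff_truncate_mono σ₁ σ₂ hmn

lemma val₂_truncate_mono : Monotone fun n => (G.truncate n).val₂ σ₂ :=
  fun _ _ hmn => iSup_mono fun σ₁ => G.expectedPayoff_truncate_mono σ₁ σ₂ hmn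

lemma lowerVal_truncate_mono : Monotone fun n => (G.truncate n).lowerVal :=
  fun _ _ hmn => iSup_mono fun σ₁ => G.val₁_truncate_mono σ₁ hmn

lemma val₂_eq_iSup_truncate : G.val₂ σ₂ = ⨆ n, (G.truncate n).val₂ σ₂ := by
  simp only [val₂, expectedPayoff_eq_iSup_truncate G]
  exact iSup_comm

lemma val₂_truncate_le (n : ℕ) : (G.truncate n).val₂ σ₂ ≤ G.val₂ σ₂ := by
  rw [val₂_eq_iSup_truncate G]
  exact le_iSup (fun n => (G.truncate n).val₂ σ₂) n

lemma lowerVal_truncate_le (n : ℕ) : (G.truncate n).lowerVal ≤ G.lowerVal :=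
  iSup_mono fun σ₁ => iInf_mono fun σ₂ => by
    rw [expectedPayoff_eq_iSup_truncate G]
    exact le_iSup (fun n => (G.truncate n).expectedPayoff σ₁ σ₂) n

end Truncate

section PayoffForm

variable {A₁ A₂ S₁ S₂ : Type*} [Fintype A₁] [Fintype A₂] [MeasurableSpace S₁] [MeasurableSpace S₂]
  (G : PursuitEvasionGame A₁ A₂ S₁ S₂) (n : ℕ)

/-- The expected payoff of the `n`-th truncation as a bilinear form in the realization vectors of
the two players. -/
def payoffForm : (History (A₁ × A₂) → ℝ) →ₗ[ℝ] (History (A₁ × A₂) → ℝ) →ₗ[ℝ] ℝ :=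
  ∑ m ∈ Finset.range (n + 1), ∑ h : Fin m → A₁ × A₂,
    (G.f m h : ℝ) • (LinearMap.mul ℝ ℝ).compl₁₂ (.proj ⟨m, h⟩) (.proj ⟨m, h⟩)

lemma payoffForm_apply (x y : History (A₁ × A₂) → ℝ) :
    G.payoffForm n x y = ∑ m ∈ Finset.range (n + 1), ∑ h : Fin m → A₁ × A₂,
      (G.f m h : ℝ) * (x ⟨m, h⟩ * y ⟨m, h⟩) := by
  simp [payoffForm, LinearMap.sum_apply]

lemma continuous_payoffForm_left (y : History (A₁ × A₂) → ℝ) :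
    Continuous (G.payoffForm n · y) := by
  simp only [payoffForm_apply]
  fun_prop

lemma continuous_payoffForm_right (x : History (A₁ × A₂) → ℝ) :
    Continuous (G.payoffForm n x) := by
  simp only [funext (payoffForm_apply G n x)]
  fun_prop

variable [MeasurableSpace A₁] [MeasurableSpace A₂]

/-- The realization vectors with which the Minimizer holds the payoff of the `n`-th truncation down
to `w`. -/
def guaranteeSet (w : ℝ≥0) : Set (History (A₁ × A₂) → ℝ) :=
  realizationSet (A := A₂) Prod.snd G.p₂ ∩ ⋂ σ₁ : BehavioralStrategy A₁ S₁,
    {y | G.payoffForm n (realizationVector Prod.fst G.p₁ σ₁) y ≤ w}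

lemma isCompact_guaranteeSet [DiscreteMeasurableSpace A₂] [Nonempty A₂] (w : ℝ≥0) :
    IsCompact (G.guaranteeSet n w) :=
  (isCompact_realizationSet Prod.snd G.p₂).inter_right <|
    isClosed_iInter fun _ => isClosed_le (G.continuous_payoffForm_right n _) continuous_const

variable [DiscreteMeasurableSpace A₁] [DiscreteMeasurableSpace A₂]

lemma expectedPayoff_truncate (σ₁ : BehavioralStrategy A₁ S₁) (σ₂ : BehavioralStrategy A₂ S₂) :
    (G.truncate n).expectedPayoff σ₁ σ₂ = ENNReal.ofReal (G.payoffForm n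
      (realizationVector Prod.fst G.p₁ σ₁) (realizationVector Prod.snd G.p₂ σ₂)) := by
  have hx := fun i => (realizationVector_mem_Icc Prod.fst G.p₁ σ₁ i).1
  have hy := fun i => (realizationVector_mem_Icc Prod.snd G.p₂ σ₂ i).1
  have hmeasure : (G.truncate n).historyMeasure σ₁ σ₂ = G.historyMeasure σ₁ σ₂ := rfl
  simp only [expectedPayoff, hmeasure, payoff_truncate, payoffForm_apply]
  rw [lintegral_finsetSum _ fun m _ => G.measurable_dailyPayoff m,
    ENNReal.ofReal_sum_of_nonneg fun m _ => Finset.sum_nonneg fun h _ =>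
      mul_nonneg (NNReal.coe_nonneg _) (mul_nonneg (hx _) (hy _))]
  refine Finset.sum_congr rfl fun m _ => ?_
  rw [lintegral_historyMeasure_prefix G σ₁ σ₂ m fun h => (G.f m h : ℝ≥0∞),
    ENNReal.ofReal_sum_of_nonneg fun h _ =>
      mul_nonneg (NNReal.coe_nonneg _) (mul_nonneg (hx _) (hy _))]
  refine Finset.sum_congr rfl fun h _ => ?_
  rw [ENNReal.ofReal_mul (NNReal.coe_nonneg _), ENNReal.ofReal_mul (hx _),
    ofReal_realizationVector, ofReal_realizationVector, ENNReal.ofReal_coe_nnreal]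

lemma val₂_truncate_le_iff (σ₂ : BehavioralStrategy A₂ S₂) (w : ℝ≥0) :
    (G.truncate n).val₂ σ₂ ≤ w ↔ ∀ σ₁ : BehavioralStrategy A₁ S₁, G.payoffForm n
      (realizationVector Prod.fst G.p₁ σ₁) (realizationVector Prod.snd G.p₂ σ₂) ≤ w := by
  simp only [val₂, iSup_le_iff, expectedPayoff_truncate, ENNReal.ofReal_le_coe]

lemma realizationVector_mem_guaranteeSet_iff {σ₂ : BehavioralStrategy A₂ S₂} {w : ℝ≥0} :
    realizationVector Prod.snd G.p₂ σ₂ ∈ G.guaranteeSet n w ↔ (G.truncate n).val₂ σ₂ ≤ w := by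
  simp [guaranteeSet, realizationSet, val₂_truncate_le_iff]

lemma guaranteeSet_antitone (w : ℝ≥0) : Antitone (G.guaranteeSet · w) := by
  rintro m n hmn _ ⟨⟨σ₂, rfl⟩, hσ₂⟩
  have hn := (G.realizationVector_mem_guaranteeSet_iff n).1 ⟨⟨σ₂, rfl⟩, hσ₂⟩
  exact (G.realizationVector_mem_guaranteeSet_iff m).2 ((G.val₂_truncate_mono σ₂ hmn).trans hn)

end PayoffForm

section UniformValue

variable {A₁ A₂ S₁ S₂ : Type*}
  [MeasurableSpace A₁] [DiscreteMeasurableSpace A₁] [Finite A₁]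
  [MeasurableSpace A₂] [DiscreteMeasurableSpace A₂] [Finite A₂] [Nonempty A₂]
  [MeasurableSpace S₁] [MeasurableSpace S₂]
  (G : PursuitEvasionGame A₁ A₂ S₁ S₂)

theorem exists_val₂_le_of_forall_truncate {w : ℝ≥0}
    (hw : ∀ n, ∃ σ₂ : BehavioralStrategy A₂ S₂, (G.truncate n).val₂ σ₂ ≤ w) :
    ∃ σ₂, G.val₂ σ₂ ≤ w := by
  cases nonempty_fintype A₁
  cases nonempty_fintype A₂
  obtain ⟨y, hy⟩ := IsCompact.nonempty_iInter_of_sequence_nonempty_isCompact_isClosed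
    (G.guaranteeSet · w) (fun n => G.guaranteeSet_antitone w n.le_succ)
    (fun n => (hw n).elim fun _ hσ₂ => ⟨_, (G.realizationVector_mem_guaranteeSet_iff n).2 hσ₂⟩)
    (G.isCompact_guaranteeSet 0 w) fun n => (G.isCompact_guaranteeSet n w).isClosed
  rw [Set.mem_iInter] at hy
  obtain ⟨σ₂, rfl⟩ := (hy 0).1
  rw [funext G.val₂_eq_iSup_truncate]
  exact ⟨σ₂, iSup_le fun n => (G.realizationVector_mem_guaranteeSet_iff n).1 (hy n)⟩

variable [Nonempty A₁]

theorem exists_isValue_truncate (n : ℕ) :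
    ∃ (v : ℝ≥0) (σ₁ : BehavioralStrategy A₁ S₁) (σ₂ : BehavioralStrategy A₂ S₂),
      (G.truncate n).IsValue v ∧ v ≤ (G.truncate n).val₁ σ₁ ∧ (G.truncate n).val₂ σ₂ ≤ v := by
  cases nonempty_fintype A₁
  cases nonempty_fintype A₂
  obtain ⟨_, ⟨σ₂, rfl⟩, _, ⟨σ₁, rfl⟩, h⟩ := exists_isSaddlePointOn_of_bilinear
    (G.payoffForm n).flip (G.continuous_payoffForm_right n) (G.continuous_payoffForm_left n)
    (realizationSet_nonempty (A := A₂) Prod.snd G.p₂) (convex_realizationSet Prod.snd G.p₂)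
    (isCompact_realizationSet Prod.snd G.p₂)
    (realizationSet_nonempty (A := A₁) Prod.fst G.p₁) (convex_realizationSet Prod.fst G.p₁)
    (isCompact_realizationSet Prod.fst G.p₁)
  have hsaddle (τ₁ : BehavioralStrategy A₁ S₁) (τ₂ : BehavioralStrategy A₂ S₂) :
      (G.truncate n).expectedPayoff τ₁ σ₂ ≤ (G.truncate n).expectedPayoff σ₁ τ₂ := by
    simp only [expectedPayoff_truncate]
    exact ENNReal.ofReal_le_ofReal (h _ ⟨τ₂, rfl⟩ _ ⟨τ₁, rfl⟩)
  have hne : (G.truncate n).expectedPayoff σ₁ σ₂ ≠ ⊤ := by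
    rw [expectedPayoff_truncate]
    exact ENNReal.ofReal_ne_top
  have hv := ENNReal.coe_toNNReal hne
  have h₁ := hv.trans_le (le_iInf fun τ₂ => hsaddle σ₁ τ₂)
  have h₂ := (iSup_le fun τ₁ => hsaddle τ₁ σ₂).trans_eq hv.symm
  exact ⟨_, σ₁, σ₂, isValue_of_le h₁ h₂, h₁, h₂⟩

theorem exists_val₂_le_iSup_lowerVal_truncate :
    ∃ σ₂, G.val₂ σ₂ ≤ ⨆ n, (G.truncate n).lowerVal := by
  rcases eq_or_ne (⨆ n, (G.truncate n).lowerVal) ⊤ with htop | htop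
  · obtain ⟨_, _, σ₂, _⟩ := G.exists_isValue_truncate 0
    exact ⟨σ₂, htop ▸ le_top⟩
  · lift ⨆ n, (G.truncate n).lowerVal to ℝ≥0 using htop with w hw
    refine G.exists_val₂_le_of_forall_truncate fun n => ?_
    obtain ⟨v, _, σ₂, hv, _, hσ₂⟩ := G.exists_isValue_truncate n
    exact ⟨σ₂, hσ₂.trans (hv.1.symm.trans_le (hw ▸ le_iSup (fun n => (G.truncate n).lowerVal) n))⟩

lemma iSup_lowerVal_truncate : ⨆ n, (G.truncate n).lowerVal = G.lowerVal := by
  obtain ⟨σ₂, hσ₂⟩ := G.exists_val₂_le_iSup_lowerVal_truncate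
  exact (iSup_le G.lowerVal_truncate_le).antisymm
    (G.lowerVal_le_upperVal.trans ((iInf_le G.val₂ σ₂).trans hσ₂))

end UniformValue

end PursuitEvasionGame

end

theorem theorem2_general {A₁ A₂ S₁ S₂ : Type*}
    [MeasurableSpace A₁] [DiscreteMeasurableSpace A₁] [Finite A₁] [Nonempty A₁]
    [MeasurableSpace A₂] [DiscreteMeasurableSpace A₂] [Finite A₂] [Nonempty A₂]
    [MeasurableSpace S₁] [MeasurableSpace S₂]
    (G : PursuitEvasionGame A₁ A₂ S₁ S₂) (hG : G.lowerVal ≠ ⊤) :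
    G.HasUniformValue := by
  obtain ⟨σ₂, hσ₂⟩ := G.exists_val₂_le_iSup_lowerVal_truncate
  have hval : G.IsValue G.lowerVal.toNNReal := by
    have hle : G.upperVal ≤ G.lowerVal := (iInf_le G.val₂ σ₂).trans
      (hσ₂.trans_eq G.iSup_lowerVal_truncate)
    simp [PursuitEvasionGame.IsValue, hG, hle.antisymm G.lowerVal_le_upperVal]
  refine ⟨⟨_, hval⟩, fun ε hε => ?_⟩
  obtain ⟨N, hN⟩ : ∃ N, G.lowerVal < (G.truncate N).lowerVal + ε := by
    rw [← lt_iSup_iff, ← ENNReal.iSup_add, G.iSup_lowerVal_truncate]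
    exact ENNReal.lt_add_right hG (by simpa using hε.ne')
  obtain ⟨v, σ₁, -, hv, hσ₁, -⟩ := G.exists_isValue_truncate N
  refine ⟨N, σ₁, σ₂, fun n hn => ?_⟩
  obtain ⟨u, -, -, hu, -, -⟩ := G.exists_isValue_truncate n
  constructor
  · refine PursuitEvasionGame.isEpsOptimal₁_of_lt hu hε ?_
    calc (u : ℝ≥0∞) = (G.truncate n).lowerVal := hu.1.symm
      _ ≤ G.lowerVal := G.lowerVal_truncate_le n
      _ < (G.truncate N).lowerVal + ε := hN
      _ ≤ (G.truncate n).val₁ σ₁ + ε := by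
        gcongr; exact (hv.1.trans_le hσ₁).trans (G.val₁_truncate_mono σ₁ hn.le)
  · refine PursuitEvasionGame.isEpsOptimal₂_of_lt hu hε ?_
    calc (G.truncate n).val₂ σ₂ ≤ G.val₂ σ₂ := G.val₂_truncate_le σ₂ n
      _ ≤ G.lowerVal := hσ₂.trans_eq G.iSup_lowerVal_truncate
      _ < (G.truncate N).lowerVal + ε := hN
      _ ≤ (G.truncate n).lowerVal + ε := by gcongr; exact G.lowerVal_truncate_mono hn.le
      _ = u + ε := by rw [hu.1]

theorem theorem2 {A₁ A₂ S₁ S₂ : Type*}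
    [MeasurableSpace A₁] [DiscreteMeasurableSpace A₁] [Finite A₁] [Nonempty A₁]
    [MeasurableSpace A₂] [DiscreteMeasurableSpace A₂] [Finite A₂] [Nonempty A₂]
    [MeasurableSpace S₁] [MeasurableSpace S₂]
    (G : PursuitEvasionGame A₁ A₂ S₁ S₂) (hG : G.IsBounded) :
    G.HasUniformValue :=
  theorem2_general G (PursuitEvasionGame.lowerVal_ne_top_of_isBounded hG)
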